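/- Let $n\ge 1$, let $\mathcal W\subset\mathbb R^d$ be a closed convex set of diameter $1$, let $\mathcal X$ be a set, and let $\{\ell(\cdot,x)\}_{x\in\mathcal X}$ be a family of differentiable, convex, $L$-Lipschitz functions over $\mathcal W$. For $\eta,\sigma>0$ and a probability measure $\mu_1$ on $\mathcal W$, randomly-stopped projected noisy SGD takes a dataset $(x_1,\dots,x_n)\in\mathcal X^n$, draws $W_1\sim\mu_1$, $T$ uniform on $\{1,\dots,n\}$ and $Z_1,\dots,Z_n\sim\mathcal N(0,I_d)$, all independent, iterates $$W_{t+1}=\Pi_{\mathcal W}\big(W_t-\eta[\nabla_w\ell(W_t,x_t)+\sigma Z_t]\big),\qquad t=1,\dots,T,$$ where $\Pi_{\mathcal W}$ is the Euclidean projection onto $\mathcal W$, and outputs only $W_{T+1}$. A randomized algorithm $\mathcal M$ on $\mathcal X^n$ is $(\varepsilon,\delta)$-DP if $\Pr(\mathcal M(\mathbb D)\in A)-e^{\varepsilon}\Pr(\mathcal M(\mathbb D')\in A)\le\delta$ for all measurable $A$ and all datasets $\mathbb D,\mathbb D'$ that differ in exactly one entry. For $\gamma\ge1$ let $$\theta_\gamma(r)=\mathsf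 Q\Big(\frac{\log\gamma}{r}-\frac r2\Big)-\gamma\,\mathsf Q\Big(\frac{\log\gamma}{r}+\frac r2\Big)\quad(r>0),\qquad \theta_\gamma(0)=0,\qquad \mathsf Q(a)=\frac1{\sqrt{2\pi}}\int_a^\infty e^{-u^2/2}\,du .$$ Then for every $\varepsilon\ge0$ the algorithm is $(\varepsilon,\delta)$-DP with $$\delta=\frac1n\,\theta_{e^\varepsilon}\Big(\frac{2L}{\sigma}\Big)\Big[1-\theta_{e^\varepsilon}\Big(\frac{1+2\eta L}{\eta\sigma}\Big)\Big]^{-1}.$$ If moreover, for some $\beta>0$, every $\ell(\cdot,x)$ is $\beta$-smooth, i.e. $\|\nabla_w\ell(w_1,x)-\nabla_w\ell(w_2,x)\|\le\beta\|w_1-w_2\|$ for all $w_1,w_2\in\mathcal W$, and $\eta\le 2/\beta$, then it is $(\varepsilon,\delta)$-DP with $$\delta=\frac1n\,\theta_{e^\varepsilon}\Big(\frac{2L}{\sigma}\Big)\Big[1-\theta_{e^\varepsilon}\Big(\frac{1}{\eta\sigma}\Big)\Big]^{-1}.$$ -/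

import Mathlib

open MeasureTheory ProbabilityTheory
open scoped NNReal

noncomputable section

namespace PNSGD

/-- The Gaussian tail function `Q a = (2π)^(-1/2) ∫_a^∞ exp (-u² / 2) du`. -/
def gaussQ (a : ℝ) : ℝ :=
  (Real.sqrt (2 * Real.pi))⁻¹ * ∫ u in Set.Ioi a, Real.exp (-u ^ 2 / 2)

/-- `θ_γ(r) = Q(log γ / r - r / 2) - γ Q(log γ / r + r / 2)` for `r > 0`, and `θ_γ(0) = 0`. This is
the hockey-stick divergence `sup_A [N(r u, I)(A) - γ N(0, I)(A)]` for a unit vector `u`, `γ ≥ 1`. -/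
def theta (γ r : ℝ) : ℝ :=
  if r = 0 then 0
  else gaussQ (Real.log γ / r - r / 2) - γ * gaussQ (Real.log γ / r + r / 2)

/-- Euclidean projection onto `W`: the point of `W` nearest to `z`. It exists and is unique when
`W` is a nonempty closed convex set (the value `z` is used when there is no nearest point). -/
def proj {d : ℕ} (W : Set (EuclideanSpace ℝ (Fin d))) (z : EuclideanSpace ℝ (Fin d)) :
    EuclideanSpace ℝ (Fin d) :=
  open Classical in
  if h : ∃ p ∈ W, ∀ q ∈ W, ‖z - p‖ ≤ ‖z - q‖ then h.choose else z

lemma proj_spec {d : ℕ} {W : Set (EuclideanSpace ℝ (Fin d))} (hne : W.Nonempty)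
    (hcl : IsClosed W) (z : EuclideanSpace ℝ (Fin d)) :
    proj W z ∈ W ∧ ∀ q ∈ W, ‖z - proj W z‖ ≤ ‖z - q‖ := by
  have h : ∃ p ∈ W, ∀ q ∈ W, ‖z - p‖ ≤ ‖z - q‖ := by
    obtain ⟨p, hp, hpd⟩ := hcl.exists_infDist_eq_dist hne z
    refine ⟨p, hp, fun q hq => ?_⟩
    rw [← dist_eq_norm, ← dist_eq_norm, ← hpd]
    exact Metric.infDist_le_dist_of_mem hq
  rw [proj, dif_pos h]
  exact h.choose_spec

/-- The iterates of projected noisy SGD on the dataset `D` with gradient field `g` (`g x w` is the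
gradient at `w` of the loss of the data point `x`), learning rate `η` and noise parameter `σ`.
The value at `t` is the iterate after `t` updates, started at `w₁` and driven by the noise `z`:
`W ↦ Π_W (W - η (g (D t) W + σ z t))`. -/
def iterate {d n : ℕ} {X : Type*} (W : Set (EuclideanSpace ℝ (Fin d)))
    (g : X → EuclideanSpace ℝ (Fin d) → EuclideanSpace ℝ (Fin d)) (η σ : ℝ) (D : Fin n → X)
    (w₁ : EuclideanSpace ℝ (Fin d)) (z : Fin n → EuclideanSpace ℝ (Fin d)) :
    ℕ → EuclideanSpace ℝ (Fin d)
  | 0 => w₁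
  | t + 1 =>
    if h : t < n then
      proj W (iterate W g η σ D w₁ z t
        - η • (g (D ⟨t, h⟩) (iterate W g η σ D w₁ z t) + σ • z ⟨t, h⟩))
    else iterate W g η σ D w₁ z t

/-- The randomness of the algorithm: initial point, stopping index (`T : Fin n` stands for stopping
after `T + 1` updates), and noise vectors. -/
abbrev Sample (d n : ℕ) : Type :=
  EuclideanSpace ℝ (Fin d) × Fin n × (Fin n → EuclideanSpace ℝ (Fin d))

/-- Initial point distributed as `μ₁`, uniform stopping index, i.i.d. standard Gaussian noise
vectors, all independent. -/
def sampleMeasure {d : ℕ} (n : ℕ) (μ₁ : Measure (EuclideanSpace ℝ (Fin d))) :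
    Measure (Sample d n) :=
  μ₁.prod ((uniformOn (Set.univ : Set (Fin n))).prod
    (Measure.pi fun _ : Fin n => stdGaussian (EuclideanSpace ℝ (Fin d))))

/-- Output of randomly-stopped projected noisy SGD: the iterate after `T + 1` updates. -/
def output {d n : ℕ} {X : Type*} (W : Set (EuclideanSpace ℝ (Fin d)))
    (g : X → EuclideanSpace ℝ (Fin d) → EuclideanSpace ℝ (Fin d)) (η σ : ℝ) (D : Fin n → X)
    (ω : Sample d n) : EuclideanSpace ℝ (Fin d) :=
  iterate W g η σ D ω.1 ω.2.2 (ω.2.1 + 1)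

/-- Two datasets neighbor at index `i`: they differ at `i` and nowhere else. -/
def Neighboring {n : ℕ} {X : Type*} (i : Fin n) (D D' : Fin n → X) : Prop :=
  D i ≠ D' i ∧ ∀ j, j ≠ i → D j = D' j

/-- `(ε, δ)`-differential privacy of a randomized algorithm `M`, which maps a dataset of size `n`
to a random variable on the probability space `(Ω, P)`. -/
def IsDP {n : ℕ} {X Ω S : Type*} [MeasurableSpace Ω] [MeasurableSpace S] (P : Measure Ω)
    (M : (Fin n → X) → Ω → S) (ε δ : ℝ) : Prop :=
  ∀ (i : Fin n) (D D' : Fin n → X), Neighboring i D D' →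
    ∀ A : Set S, MeasurableSet A →
      P.real {ω | M D ω ∈ A} - Real.exp ε * P.real {ω | M D' ω ∈ A} ≤ δ

end PNSGD

end

/-! The proof is privacy amplification by iteration. Write `γ = e^ε` and measure closeness of two
laws by the hockey-stick divergence, the supremum over `A` of `μ(A) - γ ν(A)`. Let the datasets
differ at index `i` and condition on the stopping index `T`. If the run stops before update `i`,
both outputs have the same law and contribute at most `0`, since `γ ≥ 1`. Otherwise, update `i` acts
on a common law and shifts the mean by at most `2ηL` against noise of scale `ησ`, which costs
`θ_γ(2L/σ)`. Each later update applies the same kernel to both laws. If `Δ` bounds the distance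
between the means it produces from any two points, it contracts the divergence by `θ_γ(Δ/(ησ))`.
Averaging over `T` leaves `1/n` times a geometric series.

The Gaussian bound is Neyman-Pearson on the line (`gaussianReal_sub_le_theta`), lifted to vectors by
freezing the components orthogonal to the shift. The contraction is `hockeyStick_contraction`, and
`iterateLaw_sub_le` combines the two. The triangle inequality gives `Δ = 1 + 2ηL`; nonexpansiveness
of the gradient step (`norm_gradientStep_sub_le`) gives `Δ = 1`.

The set `W` may have empty interior, so a gradient within `W` is determined only up to vectors
orthogonal to `vectorSpan ℝ W`. Projection onto `W` ignores such vectors, so `g` can be replaced by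
its tangential part, which is bounded by `L` and measurable. -/

namespace PNSGD

/-! ### Gaussian tails and the function `theta` on the line. -/

lemma gaussQ_eq_gaussianReal (a : ℝ) : gaussQ a = (gaussianReal 0 1).real (Set.Ioi a) := by
  rw [measureReal_def, gaussianReal_apply_eq_integral 0 one_ne_zero, ENNReal.toReal_ofReal, gaussQ,
    ← integral_const_mul]
  · simp [gaussianPDFReal]
  · exact setIntegral_nonneg measurableSet_Ioi fun x _ => gaussianPDFReal_nonneg _ _ _

lemma gaussQ_nonneg (a : ℝ) : 0 ≤ gaussQ a := by
  rw [gaussQ_eq_gaussianReal]; exact measureReal_nonneg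

lemma gaussQ_lt_one (a : ℝ) : gaussQ a < 1 := by
  have h := probReal_add_probReal_compl (μ := gaussianReal 0 1) (measurableSet_Ioi (a := a))
  rw [← gaussQ_eq_gaussianReal] at h
  have : 0 < (gaussianReal 0 1).real (Set.Ioi a)ᶜ := by
    rw [measureReal_def, ENNReal.toReal_pos_iff]
    refine ⟨pos_iff_ne_zero.2 fun h0 => ?_, measure_lt_top _ _⟩
    have := gaussianReal_absolutelyContinuous' 0 one_ne_zero h0
    simp at this
  linarith

lemma gaussQ_antitone : Antitone gaussQ := fun a b h => by
  rw [gaussQ_eq_gaussianReal, gaussQ_eq_gaussianReal]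
  exact measureReal_mono (Set.Ioi_subset_Ioi h)

lemma gaussianReal_real_Ioi (r t : ℝ) : (gaussianReal r 1).real (Set.Ioi t) = gaussQ (t - r) := by
  have : gaussianReal r 1 = (gaussianReal 0 1).map (· + r) := by
    rw [gaussianReal_map_add_const, zero_add]
  rw [gaussQ_eq_gaussianReal, this, map_measureReal_apply (by fun_prop) measurableSet_Ioi]
  congr 1
  ext x
  simp [sub_lt_iff_lt_add]

lemma gaussianReal_real_eq_integral (r : ℝ) (B : Set ℝ) :
    (gaussianReal r 1).real B = ∫ x in B, gaussianPDFReal r 1 x := by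
  rw [measureReal_def, gaussianReal_apply_eq_integral r one_ne_zero, ENNReal.toReal_ofReal]
  exact integral_nonneg fun x => gaussianPDFReal_nonneg _ _ _

lemma gaussianPDFReal_shift_eq (r x : ℝ) :
    gaussianPDFReal r 1 x = Real.exp (r * x - r ^ 2 / 2) * gaussianPDFReal 0 1 x := by
  simp only [gaussianPDFReal]
  rw [mul_left_comm, ← Real.exp_add]
  congr 2
  push_cast
  ring

/-- Neyman-Pearson: among all measurable sets, a half-line maximizes the difference. -/
lemma gaussianReal_sub_le_theta {γ r : ℝ} (hγ : 1 ≤ γ) (hr : 0 < r) {B : Set ℝ}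
    (hB : MeasurableSet B) :
    (gaussianReal r 1).real B - γ * (gaussianReal 0 1).real B ≤ theta γ r := by
  -- The point where the likelihood ratio `exp (r x - r² / 2)` equals `γ`; the integrand `F` changes
  -- sign there.
  set t := Real.log γ / r + r / 2 with ht
  set F : ℝ → ℝ := fun x => gaussianPDFReal r 1 x - γ * gaussianPDFReal 0 1 x with hF
  have hFint : Integrable F :=
    (integrable_gaussianPDFReal r 1).sub ((integrable_gaussianPDFReal 0 1).const_mul γ)
  have key (C : Set ℝ) : (gaussianReal r 1).real C - γ * (gaussianReal 0 1).real C =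
      ∫ x in C, F x := by
    rw [gaussianReal_real_eq_integral, gaussianReal_real_eq_integral, ← integral_const_mul,
      ← integral_sub (integrable_gaussianPDFReal r 1).integrableOn
        ((integrable_gaussianPDFReal 0 1).const_mul γ).integrableOn]
  have hsign (x : ℝ) : F x = (Real.exp (r * x - r ^ 2 / 2) - Real.exp (Real.log γ))
      * gaussianPDFReal 0 1 x := by
    rw [Real.exp_log (by linarith), hF]
    simp only
    rw [gaussianPDFReal_shift_eq]; ring
  have hrt : r * t = Real.log γ + r ^ 2 / 2 := by
    rw [ht]; field_simp
  have hpos : ∀ x ∈ Set.Ioi t, 0 ≤ F x := fun x hx => by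
    rw [hsign]
    refine mul_nonneg (sub_nonneg.2 (Real.exp_le_exp.2 ?_)) (gaussianPDFReal_nonneg _ _ _)
    have := mul_lt_mul_of_pos_left hx.out hr
    linarith
  have hneg : ∀ x, x ∉ Set.Ioi t → F x ≤ 0 := fun x hx => by
    rw [hsign]
    refine mul_nonpos_of_nonpos_of_nonneg (sub_nonpos.2 (Real.exp_le_exp.2 ?_))
      (gaussianPDFReal_nonneg _ _ _)
    have := mul_le_mul_of_nonneg_left (not_lt.1 hx) hr.le
    linarith
  have htheta : theta γ r = ∫ x in Set.Ioi t, F x := by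
    rw [← key, gaussianReal_real_Ioi, gaussianReal_real_Ioi, theta, if_neg hr.ne', sub_zero, ht]
    congr 2
    ring
  rw [key, htheta, ← integral_indicator hB, ← integral_indicator measurableSet_Ioi]
  refine integral_mono (hFint.indicator hB) (hFint.indicator measurableSet_Ioi) fun x => ?_
  by_cases hx : x ∈ Set.Ioi t
  · rw [Set.indicator_of_mem hx]
    exact Set.indicator_le_self' (fun _ _ => hpos x hx) x
  · rw [Set.indicator_of_notMem hx]
    exact Set.indicator_apply_nonpos fun _ => hneg x hx

lemma halfline_le_theta {γ r : ℝ} (hγ : 1 ≤ γ) (hr : 0 < r) (t : ℝ) :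
    gaussQ (t - r) - γ * gaussQ t ≤ theta γ r := by
  have := gaussianReal_sub_le_theta hγ hr (measurableSet_Ioi (a := t))
  rwa [gaussianReal_real_Ioi, gaussianReal_real_Ioi, sub_zero] at this

lemma theta_nonneg {γ r : ℝ} (hγ : 1 ≤ γ) (hr : 0 ≤ r) : 0 ≤ theta γ r := by
  rcases hr.eq_or_lt with rfl | hr
  · simp [theta]
  · simpa using gaussianReal_sub_le_theta hγ hr MeasurableSet.empty

/-- The optimal half-line for `r` is a competitor for `s`, and moving the mean further right only
increases its mass. -/
lemma theta_mono {γ r s : ℝ} (hγ : 1 ≤ γ) (hr : 0 ≤ r) (hrs : r ≤ s) :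
    theta γ r ≤ theta γ s := by
  rcases hr.eq_or_lt with rfl | hr
  · simpa [theta] using theta_nonneg hγ hrs
  · refine le_trans ?_ (halfline_le_theta hγ (hr.trans_le hrs) (Real.log γ / r + r / 2))
    rw [theta, if_neg hr.ne']
    gcongr
    exact gaussQ_antitone (by linarith)

lemma theta_lt_one {γ r : ℝ} (hγ : 0 ≤ γ) : theta γ r < 1 := by
  unfold theta
  split_ifs
  · exact one_pos
  · have h₁ := gaussQ_lt_one (Real.log γ / r - r / 2)
    have h₂ := mul_nonneg hγ (gaussQ_nonneg (Real.log γ / r + r / 2))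
    linarith

/-! ### Hockey-stick divergence of shifted Gaussian vectors. -/

section Euclidean

variable {E : Type*} [NormedAddCommGroup E] [InnerProductSpace ℝ E] [FiniteDimensional ℝ E]
  [MeasurableSpace E] [BorelSpace E]

open scoped RealInnerProductSpace MeasureTheory in
/-- Resampling the component of a standard Gaussian vector along a unit vector. -/
lemma stdGaussian_eq_map_resample {u : E} (hu : ‖u‖ = 1) :
    stdGaussian E = ((gaussianReal 0 1).prod (stdGaussian E)).map
      (fun p => p.1 • u + (p.2 - ⟪u, p.2⟫ • u)) := by
  set f : ℝ → E := fun x => x • u with hf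
  set q : E → E := fun z => z - ⟪u, z⟫ • u with hq
  have hfm : Measurable f := by fun_prop
  have hqm : Measurable q := by fun_prop
  have hmap : ((gaussianReal 0 1).prod (stdGaussian E)).map (fun p => f p.1 + q p.2) =
      ((gaussianReal 0 1).map f) ∗ ((stdGaussian E).map q) := by
    rw [Measure.conv, Measure.map_prod_map _ _ hfm hqm, Measure.map_map (by fun_prop)
      (by fun_prop)]
    rfl
  change _ = ((gaussianReal 0 1).prod (stdGaussian E)).map (fun p => f p.1 + q p.2)
  have : IsProbabilityMeasure ((gaussianReal 0 1).map f) :=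
    Measure.isProbabilityMeasure_map hfm.aemeasurable
  have : IsProbabilityMeasure ((stdGaussian E).map q) :=
    Measure.isProbabilityMeasure_map hqm.aemeasurable
  rw [hmap]
  refine Measure.ext_of_charFun (funext fun t => ?_)
  have h₁ : charFun ((gaussianReal 0 1).map f) t = charFun (gaussianReal 0 1) ⟪u, t⟫ := by
    rw [charFun_apply, charFun_apply_real, integral_map hfm.aemeasurable (by fun_prop)]
    refine integral_congr_ae (ae_of_all _ fun x => ?_)
    simp only [hf, real_inner_smul_left]
    push_cast
    ring_nf
  have h₂ : charFun ((stdGaussian E).map q) t = charFun (stdGaussian E) (q t) := by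
    rw [charFun_apply, charFun_apply, integral_map hqm.aemeasurable (by fun_prop)]
    refine integral_congr_ae (ae_of_all _ fun x => ?_)
    simp only [hq, inner_sub_left, inner_sub_right, real_inner_smul_left, real_inner_smul_right,
      real_inner_comm u x, mul_comm]
  -- Pythagoras: this makes the product of the two Gaussian characteristic functions that of the
  -- full vector.
  have hn : ‖t‖ ^ 2 = ⟪u, t⟫ ^ 2 + ‖q t‖ ^ 2 := by
    rw [hq, norm_sub_sq_real, norm_smul, hu, real_inner_smul_right, real_inner_comm t u]
    simp only [Real.norm_eq_abs, mul_one, sq_abs]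
    ring
  rw [charFun_conv, h₁, h₂, charFun_gaussianReal, charFun_stdGaussian, charFun_stdGaussian,
    ← Complex.exp_add]
  congr 1
  rw [← Complex.ofReal_pow, hn]
  push_cast
  ring

/-- With the component orthogonal to `v` frozen, the shift is a one-dimensional translation by
`‖v‖`. The bound on the line is uniform in the frozen component, so it survives integration. -/
lemma stdGaussian_shift_le_theta {γ : ℝ} (hγ : 1 ≤ γ) (v : E) {A : Set E}
    (hA : MeasurableSet A) :
    (stdGaussian E).real {z | z + v ∈ A} - γ * (stdGaussian E).real A ≤ theta γ ‖v‖ := by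
  rcases eq_or_ne v 0 with rfl | hv
  · have : (0 : ℝ) ≤ (γ - 1) * (stdGaussian E).real A :=
      mul_nonneg (by linarith) measureReal_nonneg
    simp [theta]
    linarith
  have hr : 0 < ‖v‖ := norm_pos_iff.2 hv
  set u : E := ‖v‖⁻¹ • v with hu_def
  have hu : ‖u‖ = 1 := by rw [hu_def, norm_smul, norm_inv, norm_norm, inv_mul_cancel₀ hr.ne']
  have hvu : v = ‖v‖ • u := by rw [hu_def, smul_inv_smul₀ hr.ne']
  set q : E → E := fun z => z - (inner ℝ u z : ℝ) • u with hq
  have hqm : Measurable q := by fun_prop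
  have hmeas : Measurable (fun p : ℝ × E => p.1 • u + q p.2) := by fun_prop
  have real_eq (C : Set E) (hC : MeasurableSet C) : (stdGaussian E).real C =
      ∫ z, (gaussianReal 0 1).real {x | x • u + q z ∈ C} ∂(stdGaussian E) := by
    conv_lhs => rw [stdGaussian_eq_map_resample hu]
    rw [map_measureReal_apply hmeas hC, measureReal_def, Measure.prod_apply_symm (hmeas hC),
      ← integral_toReal]
    · rfl
    · exact (measurable_measure_prodMk_right (hmeas hC)).aemeasurable
    · exact ae_of_all _ fun z => measure_lt_top _ _
  have hint (C : Set E) (hC : MeasurableSet C) :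
      Integrable (fun z => (gaussianReal 0 1).real {x | x • u + q z ∈ C}) (stdGaussian E) := by
    refine Integrable.of_bound (C := 1) ?_ (ae_of_all _ fun z => ?_)
    · exact (measurable_measure_prodMk_right (hmeas hC)).ennreal_toReal.aestronglyMeasurable
    · rw [Real.norm_of_nonneg measureReal_nonneg]
      exact measureReal_le_one
  have hA' : MeasurableSet {z | z + v ∈ A} := (measurable_add_const v) hA
  rw [real_eq _ hA', real_eq _ hA, ← integral_const_mul,
    ← integral_sub (hint _ hA') ((hint _ hA).const_mul γ)]
  have hbound : ∀ z, (gaussianReal 0 1).real {x | x • u + q z ∈ {z | z + v ∈ A}} -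
      γ * (gaussianReal 0 1).real {x | x • u + q z ∈ A} ≤ theta γ ‖v‖ := fun z => by
    have hB : MeasurableSet {x : ℝ | x • u + q z ∈ A} :=
      (by fun_prop : Measurable fun x : ℝ => x • u + q z) hA
    have hshift : gaussianReal ‖v‖ 1 = (gaussianReal 0 1).map (· + ‖v‖) := by
      rw [gaussianReal_map_add_const, zero_add]
    have := gaussianReal_sub_le_theta hγ hr hB
    rw [hshift, map_measureReal_apply (by fun_prop) hB] at this
    convert this using 4
    ext x
    simp only [Set.mem_ofPred_eq, Set.mem_preimage]
    rw [add_smul, ← hvu, add_right_comm]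
  calc _ ≤ ∫ _, theta γ ‖v‖ ∂(stdGaussian E) :=
        integral_mono ((hint _ hA').sub ((hint _ hA).const_mul γ)) (integrable_const _) hbound
    _ = theta γ ‖v‖ := by simp

/-- Scaled version: the hockey-stick divergence of two Gaussians with scale `s`, after
post-processing. -/
lemma stdGaussian_affine_le_theta {γ s : ℝ} (hγ : 1 ≤ γ) (hs : 0 < s) (a b : E) {A : Set E}
    (hA : MeasurableSet A) :
    (stdGaussian E).real {z | a - s • z ∈ A} - γ * (stdGaussian E).real {z | b - s • z ∈ A} ≤
      theta γ (‖a - b‖ / s) := by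
  have hA' : MeasurableSet {z | b - s • z ∈ A} := (by fun_prop : Measurable fun z : E => b - s • z) hA
  have := stdGaussian_shift_le_theta hγ (s⁻¹ • (b - a)) hA'
  rw [norm_smul, norm_inv, Real.norm_of_nonneg hs.le, norm_sub_rev, inv_mul_eq_div] at this
  convert this using 4
  ext z
  simp only [Set.mem_ofPred_eq, smul_add, smul_inv_smul₀ hs.ne']
  rw [show b - (s • z + (b - a)) = a - s • z by abel]

end Euclidean


/-! ### Contraction under kernels, and independence in product measures. -/

/-- A Markov kernel whose outputs have pairwise hockey-stick divergence at most `c` contracts the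
hockey-stick divergence by the factor `c` (stated for the probability `h` of one event). -/
lemma hockeyStick_contraction {α : Type*} [MeasurableSpace α] {μ ν : Measure α}
    [IsProbabilityMeasure μ] [IsProbabilityMeasure ν] {γ p c : ℝ} (hγ : 1 ≤ γ)
    (hp : ∀ A, MeasurableSet A → μ.real A - γ * ν.real A ≤ p) (hp1 : p ≤ 1) (hc : 0 ≤ c)
    {h : α → ℝ} (hm : Measurable h) (h0 : ∀ x, 0 ≤ h x) (h1 : ∀ x, h x ≤ 1)
    (hosc : ∀ x y, h x - γ * h y ≤ c) :
    ∫ x, h x ∂μ - γ * ∫ x, h x ∂ν ≤ p * c := by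
  have hne : Nonempty α := nonempty_of_isProbabilityMeasure μ
  have hγ0 : 0 ≤ γ := by linarith
  set m := ⨅ x, h x with hmdef
  have hbdd : BddBelow (Set.range h) := ⟨0, by rintro _ ⟨x, rfl⟩; exact h0 x⟩
  have hmh (x : α) : m ≤ h x := ciInf_le hbdd x
  have hm0 : 0 ≤ m := le_ciInf h0
  -- The oscillation bound with the infimum taken over `y`: all values of `h` lie between `m` and `c
  -- + γ m`.
  have hM (x : α) : h x ≤ c + γ * m := by
    have : (h x - c) / γ ≤ m := le_ciInf fun y => by
      rw [div_le_iff₀ (by linarith)]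
      have := hosc x y
      linarith
    rw [div_le_iff₀ (by linarith)] at this
    linarith
  set ν' : Measure α := γ.toNNReal • ν with hν'
  have hν'real (A : Set α) : ν'.real A = γ * ν.real A := by
    rw [hν', measureReal_nnreal_smul_apply, Real.coe_toNNReal _ hγ0]
  have hν'int (f : α → ℝ) (A : Set α) : ∫ x in A, f x ∂ν' = γ * ∫ x in A, f x ∂ν := by
    rw [hν', Measure.restrict_smul, integral_smul_nnreal_measure, NNReal.smul_def,
      Real.coe_toNNReal _ hγ0, smul_eq_mul]
  -- On the part where `μ` dominates `γ ν`, `h` is replaced by its upper bound `c + γ m`; on the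
  -- complement, by its lower bound `m`.
  obtain ⟨s, hs, hs₁, hs₂⟩ := hahn_decomposition μ ν'
  have hle₁ : ν'.restrict s ≤ μ.restrict s := Measure.le_iff.2 fun t ht => by
    rw [Measure.restrict_apply ht, Measure.restrict_apply ht]
    exact hs₁ _ (ht.inter hs) Set.inter_subset_right
  have hle₂ : μ.restrict sᶜ ≤ ν'.restrict sᶜ := Measure.le_iff.2 fun t ht => by
    rw [Measure.restrict_apply ht, Measure.restrict_apply ht]
    exact hs₂ _ (ht.inter hs.compl) Set.inter_subset_right
  have hint (κ : Measure α) [IsFiniteMeasure κ] : Integrable h κ :=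
    Integrable.of_bound hm.aestronglyMeasurable 1
      (ae_of_all _ fun x => by rw [Real.norm_of_nonneg (h0 x)]; exact h1 x)
  have e₁ : ∫ x in s, (c + γ * m - h x) ∂ν' ≤ ∫ x in s, (c + γ * m - h x) ∂μ :=
    integral_mono_measure hle₁ (ae_of_all _ fun x => sub_nonneg.2 (hM x))
      ((integrable_const _).sub (hint _))
  have e₂ : ∫ x in sᶜ, (h x - m) ∂μ ≤ ∫ x in sᶜ, (h x - m) ∂ν' :=
    integral_mono_measure hle₂ (ae_of_all _ fun x => sub_nonneg.2 (hmh x))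
      ((hint _).sub (integrable_const _))
  rw [hν'int] at e₁ e₂
  rw [integral_sub (integrable_const _) (hint _), integral_sub (integrable_const _) (hint _)] at e₁
  rw [integral_sub (hint _) (integrable_const _), integral_sub (hint _) (integrable_const _)] at e₂
  simp only [integral_const, measureReal_restrict_apply_univ, smul_eq_mul] at e₁ e₂
  have hμs := probReal_add_probReal_compl (μ := μ) hs
  have hνs := probReal_add_probReal_compl (μ := ν) hs
  have hsp := hp s hs
  rw [← integral_add_compl hs (hint μ), ← integral_add_compl hs (hint ν)]
  have hμc : μ.real sᶜ = 1 - μ.real s := by linarith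
  have hνc : ν.real sᶜ = 1 - ν.real s := by linarith
  rw [hμc, hνc] at e₂
  -- The two bounds add up to `c q - m (γ - 1) (1 - q)`, and `q ≤ p ≤ 1`.
  set q := μ.real s - γ * ν.real s with hq
  have f₁ : c * q ≤ c * p := mul_le_mul_of_nonneg_left hsp hc
  have f₂ : 0 ≤ m * (γ - 1) * (1 - q) :=
    mul_nonneg (mul_nonneg hm0 (by linarith)) (by linarith)
  nlinarith

/-- Replacing one coordinate by a fresh independent copy keeps the product law; it suffices to
compare boxes. -/
lemma measurePreserving_update {ι : Type*} [Fintype ι] [DecidableEq ι] {α : ι → Type*}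
    [∀ i, MeasurableSpace (α i)] (μ : ∀ i, Measure (α i)) [∀ i, IsProbabilityMeasure (μ i)]
    (t : ι) :
    MeasurePreserving (fun p : (∀ i, α i) × α t => Function.update p.1 t p.2)
      ((Measure.pi μ).prod (μ t)) (Measure.pi μ) := by
  have hmeas : Measurable (fun p : (∀ i, α i) × α t => Function.update p.1 t p.2) := by
    refine measurable_pi_lambda _ fun i => ?_
    by_cases hi : i = t
    · subst hi
      simpa using measurable_snd
    · simp only [Function.update_of_ne hi]
      fun_prop
  refine ⟨hmeas, (Measure.pi_eq fun s hs => ?_).symm⟩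
  rw [Measure.map_apply hmeas (MeasurableSet.univ_pi hs)]
  have : (fun p : (∀ i, α i) × α t => Function.update p.1 t p.2) ⁻¹' Set.univ.pi s =
      (Set.univ.pi (Function.update s t Set.univ)) ×ˢ s t := by
    ext p
    simp only [Set.mem_preimage, Set.mem_pi, Set.mem_univ, true_implies, Set.mem_prod]
    constructor
    · intro h
      refine ⟨fun i => ?_, by simpa using h t⟩
      by_cases hi : i = t
      · subst hi; simp
      · simpa [hi] using h i
    · rintro ⟨h, ht⟩ i
      by_cases hi : i = t
      · subst hi; simpa using ht
      · simpa [hi] using h i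
  rw [this, Measure.prod_prod, Measure.pi_pi, ← Finset.mul_prod_erase _ _ (Finset.mem_univ t),
    ← Finset.mul_prod_erase Finset.univ (fun i => μ i (s i)) (Finset.mem_univ t)]
  simp only [Function.update_self, measure_univ, one_mul]
  rw [mul_comm]
  congr 1
  refine Finset.prod_congr rfl fun i hi => ?_
  rw [Function.update_of_ne (Finset.ne_of_mem_erase hi)]

/-- A random variable that does not depend on the coordinate `t` is independent of it. -/
lemma map_prodMk_eval_eq_prod {ι β α δ : Type*} [Fintype ι] [DecidableEq ι] [MeasurableSpace α]
    [MeasurableSpace β] [MeasurableSpace δ] (μ₁ : Measure β) [IsProbabilityMeasure μ₁]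
    (g : Measure α) [IsProbabilityMeasure g] (t : ι) {F : β × (ι → α) → δ} (hF : Measurable F)
    (hFt : ∀ w z y, F (w, Function.update z t y) = F (w, z)) :
    (μ₁.prod (Measure.pi fun _ : ι => g)).map (fun ω => (F ω, ω.2 t)) =
      ((μ₁.prod (Measure.pi fun _ : ι => g)).map F).prod g := by
  -- Resampling coordinate `t` leaves `F` unchanged and turns that coordinate into the independent
  -- fresh copy.
  have hψ := ((MeasurePreserving.id μ₁).prod
    (measurePreserving_update (fun _ : ι => g) t)).comp
    (measurePreserving_prodAssoc μ₁ (Measure.pi fun _ : ι => g) g)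
  have hpair : Measurable (fun ω : β × (ι → α) => (F ω, ω.2 t)) := by fun_prop
  conv_lhs => rw [← hψ.map_eq]
  rw [Measure.map_map hpair hψ.measurable]
  have hprod := Measure.map_prod_map (μ₁.prod (Measure.pi fun _ : ι => g)) g hF measurable_id
  rw [Measure.map_id] at hprod
  rw [hprod]
  congr 1
  ext ⟨⟨w, z⟩, y⟩ : 1
  simp [MeasurableEquiv.prodAssoc, hFt]

lemma sum_shifted_geometric_le {a c : ℝ} (ha : 0 ≤ a) (hc0 : 0 ≤ c) (hc1 : c < 1) {n : ℕ}
    (i : Fin n) :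
    ∑ T : Fin n, (if (i : ℕ) ≤ T then a * c ^ ((T : ℕ) - i) else 0) ≤ a * (1 - c)⁻¹ := by
  rw [Fin.sum_univ_eq_sum_range fun t => if (i : ℕ) ≤ t then a * c ^ (t - i) else 0]
  obtain ⟨i, hi⟩ := i
  obtain ⟨m, rfl⟩ := Nat.exists_eq_add_of_le hi.le
  rw [Finset.sum_range_add, Finset.sum_eq_zero, zero_add]
  · simp only [le_add_iff_nonneg_right, zero_le, if_true, add_tsub_cancel_left]
    rw [← Finset.mul_sum, ← tsum_geometric_of_lt_one hc0 hc1]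
    exact mul_le_mul_of_nonneg_left ((summable_geometric_of_lt_one hc0 hc1).sum_le_tsum _
      fun _ _ => pow_nonneg hc0 _) ha
  · intro t ht
    rw [if_neg (by simpa using ht)]

/-! ### Privacy of an abstract noisy iteration with random stopping. -/

section Abstract

variable {E : Type*} [NormedAddCommGroup E] [InnerProductSpace ℝ E] {X : Type*} {n : ℕ}

/-- The iteration `w ↦ r (Φ x w - s z)`, with data `x = D t` and noise `z t` in step `t`. -/
noncomputable def noisyIterate (r : E → E) (Φ : X → E → E) (s : ℝ) (D : Fin n → X) (w₁ : E)
    (z : Fin n → E) : ℕ → E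
  | 0 => w₁
  | t + 1 =>
    if h : t < n then r (Φ (D ⟨t, h⟩) (noisyIterate r Φ s D w₁ z t) - s • z ⟨t, h⟩)
    else noisyIterate r Φ s D w₁ z t

variable {r : E → E} {Φ : X → E → E} {s : ℝ}

/-- Iterate `t` has read only the noise with index below `t`, so it is independent of `z t`, the
noise of the next update. -/
lemma noisyIterate_update (D : Fin n → X) (w₁ : E) (z : Fin n → E) (j : Fin n) (y : E) (t : ℕ)
    (htj : t ≤ j) :
    noisyIterate r Φ s D w₁ (Function.update z j y) t = noisyIterate r Φ s D w₁ z t := by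
  induction t with
  | zero => rfl
  | succ t ih =>
    simp only [noisyIterate]
    split_ifs with h
    · rw [ih (by omega), Function.update_of_ne]
      exact fun hj => by rw [← hj] at htj; simp at htj
    · exact ih (by omega)

lemma noisyIterate_congr {D D' : Fin n → X} {i : Fin n} (hD : ∀ j, j ≠ i → D j = D' j) (w₁ : E)
    (z : Fin n → E) (t : ℕ) (hti : t ≤ i) :
    noisyIterate r Φ s D w₁ z t = noisyIterate r Φ s D' w₁ z t := by
  induction t with
  | zero => rfl
  | succ t ih =>
    simp only [noisyIterate]
    rw [ih (by omega)]
    split_ifs with h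
    · rw [hD]
      exact fun hj => by rw [← hj] at hti; simp at hti
    · rfl

variable [FiniteDimensional ℝ E] [MeasurableSpace E] [BorelSpace E]

lemma measurable_noisyIterate (hr : Measurable r) (hΦ : ∀ x, Measurable (Φ x)) (D : Fin n → X)
    (t : ℕ) : Measurable fun ω : E × (Fin n → E) => noisyIterate r Φ s D ω.1 ω.2 t := by
  induction t with
  | zero => exact measurable_fst
  | succ t ih =>
    simp only [noisyIterate]
    split_ifs with h
    · have := hΦ (D ⟨t, h⟩)
      fun_prop
    · exact ih

/-- The law of the iterate after `t` updates. -/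
noncomputable def iterateLaw (r : E → E) (Φ : X → E → E) (s : ℝ) (D : Fin n → X) (μ₁ : Measure E)
    (t : ℕ) : Measure E :=
  (μ₁.prod (Measure.pi fun _ : Fin n => stdGaussian E)).map
    fun ω => noisyIterate r Φ s D ω.1 ω.2 t

variable {μ₁ : Measure E} [IsProbabilityMeasure μ₁]

lemma isProbabilityMeasure_iterateLaw (hr : Measurable r) (hΦ : ∀ x, Measurable (Φ x))
    (D : Fin n → X) (t : ℕ) : IsProbabilityMeasure (iterateLaw r Φ s D μ₁ t) :=
  Measure.isProbabilityMeasure_map (measurable_noisyIterate hr hΦ D t).aemeasurable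

lemma measurable_stepProb (hr : Measurable r) {φ : E → E} (hφ : Measurable φ) {A : Set E}
    (hA : MeasurableSet A) :
    Measurable fun w => (stdGaussian E).real {z | r (φ w - s • z) ∈ A} := by
  have : Measurable fun p : E × E => r (φ p.1 - s • p.2) := by fun_prop
  exact (measurable_measure_prodMk_left (this hA)).ennreal_toReal

lemma integrable_stepProb (hr : Measurable r) {φ : E → E} (hφ : Measurable φ) {A : Set E}
    (hA : MeasurableSet A) (κ : Measure E) [IsFiniteMeasure κ] :
    Integrable (fun w => (stdGaussian E).real {z | r (φ w - s • z) ∈ A}) κ :=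
  Integrable.of_bound (measurable_stepProb hr hφ hA).aestronglyMeasurable 1
    (ae_of_all _ fun w => by rw [Real.norm_of_nonneg measureReal_nonneg]; exact measureReal_le_one)

/-- The Markov property: each update pushes the current law through the Gaussian kernel of that
step. -/
lemma iterateLaw_succ (hr : Measurable r) (hΦ : ∀ x, Measurable (Φ x)) (D : Fin n → X) {t : ℕ}
    (ht : t < n) {A : Set E} (hA : MeasurableSet A) :
    (iterateLaw r Φ s D μ₁ (t + 1)).real A =
      ∫ w, (stdGaussian E).real {z | r (Φ (D ⟨t, ht⟩) w - s • z) ∈ A}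
        ∂(iterateLaw r Φ s D μ₁ t) := by
  have := isProbabilityMeasure_iterateLaw (s := s) (μ₁ := μ₁) hr hΦ D t
  have hΦt := hΦ (D ⟨t, ht⟩)
  have hstep : Measurable fun p : E × E => r (Φ (D ⟨t, ht⟩) p.1 - s • p.2) := by fun_prop
  have hit := measurable_noisyIterate (s := s) hr hΦ D t
  have hlaw : iterateLaw r Φ s D μ₁ (t + 1) =
      ((iterateLaw r Φ s D μ₁ t).prod (stdGaussian E)).map
        fun p => r (Φ (D ⟨t, ht⟩) p.1 - s • p.2) := by
    rw [iterateLaw, iterateLaw, ← map_prodMk_eval_eq_prod μ₁ (stdGaussian E) ⟨t, ht⟩ hit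
      fun w z y => noisyIterate_update D w z _ y t le_rfl, Measure.map_map hstep (by fun_prop)]
    congr 1
    ext ω : 1
    simp [noisyIterate, ht]
  rw [hlaw, map_measureReal_apply hstep hA, measureReal_def, Measure.prod_apply (hstep hA),
    ← integral_toReal]
  · rfl
  · exact (measurable_measure_prodMk_left (hstep hA)).aemeasurable
  · exact ae_of_all _ fun z => measure_lt_top _ _

variable {γ κ Δ : ℝ}

lemma stepProb_sub_le (hγ : 1 ≤ γ) (hs : 0 < s) (hr : Measurable r) {a b : E} (hab : ‖a - b‖ ≤ κ)
    {A : Set E} (hA : MeasurableSet A) :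
    (stdGaussian E).real {z | r (a - s • z) ∈ A} - γ * (stdGaussian E).real {z | r (b - s • z) ∈ A}
      ≤ theta γ (κ / s) :=
  (stdGaussian_affine_le_theta hγ hs a b (hr hA)).trans
    (theta_mono hγ (by positivity) (by gcongr))

/-- Here `k` counts the updates after the differing one. In the base case the laws before the update
agree and only the maps differ (`κ`); in the induction step the maps agree and only the laws differ,
so the contraction with `Δ` applies. -/
lemma iterateLaw_sub_le (hγ : 1 ≤ γ) (hs : 0 < s) (hr : Measurable r)
    (hΦ : ∀ x, Measurable (Φ x)) (hΔ : ∀ x w w', ‖Φ x w - Φ x w'‖ ≤ Δ)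
    (hκ : ∀ x x' w, ‖Φ x w - Φ x' w‖ ≤ κ) {D D' : Fin n → X} {i : Fin n}
    (hD : ∀ j, j ≠ i → D j = D' j) (k : ℕ) (hk : i + k < n) (A : Set E) (hA : MeasurableSet A) :
    (iterateLaw r Φ s D μ₁ (i + k + 1)).real A - γ * (iterateLaw r Φ s D' μ₁ (i + k + 1)).real A ≤
      theta γ (κ / s) * theta γ (Δ / s) ^ k := by
  have hP (D : Fin n → X) (t : ℕ) := isProbabilityMeasure_iterateLaw (s := s) (μ₁ := μ₁) hr hΦ D t
  have hκ0 : 0 ≤ κ := (norm_nonneg _).trans (hκ (D i) (D i) 0)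
  have hΔ0 : 0 ≤ Δ := (norm_nonneg _).trans (hΔ (D i) 0 0)
  have hθκ : 0 ≤ theta γ (κ / s) := theta_nonneg hγ (by positivity)
  have hθΔ : 0 ≤ theta γ (Δ / s) := theta_nonneg hγ (by positivity)
  induction k generalizing A with
  | zero =>
    simp only [add_zero, pow_zero, mul_one] at hk ⊢
    have hlaw : iterateLaw r Φ s D' μ₁ i = iterateLaw r Φ s D μ₁ i := by
      unfold iterateLaw
      congr 1
      ext ω : 1
      exact (noisyIterate_congr hD ω.1 ω.2 i le_rfl).symm
    rw [iterateLaw_succ hr hΦ D hk hA, iterateLaw_succ hr hΦ D' hk hA, hlaw,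
      ← integral_const_mul, ← integral_sub (integrable_stepProb hr (hΦ _) hA _)
        ((integrable_stepProb hr (hΦ _) hA _).const_mul γ)]
    calc _ ≤ ∫ _, theta γ (κ / s) ∂(iterateLaw r Φ s D μ₁ i) :=
          integral_mono ((integrable_stepProb hr (hΦ _) hA _).sub
            ((integrable_stepProb hr (hΦ _) hA _).const_mul γ)) (integrable_const _)
            fun w => stepProb_sub_le hγ hs hr (hκ _ _ w) hA
      _ = _ := by simp
  | succ k ih =>
    have hDk : D ⟨i + (k + 1), hk⟩ = D' ⟨i + (k + 1), hk⟩ := hD _ fun h => by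
      have := congrArg Fin.val h
      simp at this
    rw [iterateLaw_succ hr hΦ D hk hA, iterateLaw_succ hr hΦ D' hk hA, hDk, pow_succ, ← mul_assoc]
    refine hockeyStick_contraction hγ (ih (by omega)) ?_ hθΔ (measurable_stepProb hr (hΦ _) hA)
      (fun _ => measureReal_nonneg) (fun _ => measureReal_le_one)
      fun w w' => stepProb_sub_le hγ hs hr (hΔ _ w w') hA
    exact mul_le_one₀ (theta_lt_one (by linarith)).le (pow_nonneg hθΔ _)
      (pow_le_one₀ hθΔ (theta_lt_one (by linarith)).le)

lemma stopped_real_eq_sum (hn : 1 ≤ n) (hr : Measurable r) (hΦ : ∀ x, Measurable (Φ x))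
    (D : Fin n → X) {A : Set E} (hA : MeasurableSet A) :
    (μ₁.prod ((uniformOn (Set.univ : Set (Fin n))).prod
      (Measure.pi fun _ : Fin n => stdGaussian E))).real
        {ω | noisyIterate r Φ s D ω.1 ω.2.2 (ω.2.1 + 1) ∈ A} =
      1 / (n : ℝ) * ∑ T : Fin n, (iterateLaw r Φ s D μ₁ (T + 1)).real A := by
  have : Nonempty (Fin n) := ⟨⟨0, hn⟩⟩
  have hjoint : Measurable fun p : Fin n × (E × (Fin n → E)) =>
      noisyIterate r Φ s D p.2.1 p.2.2 (p.1 + 1) :=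
    measurable_from_prod_countable_right fun T => measurable_noisyIterate hr hΦ D (T + 1)
  have hS : MeasurableSet {ω : E × Fin n × (Fin n → E) |
      noisyIterate r Φ s D ω.1 ω.2.2 (ω.2.1 + 1) ∈ A} :=
    (hjoint.comp (by fun_prop : Measurable fun ω : E × Fin n × (Fin n → E) =>
      (ω.2.1, (ω.1, ω.2.2)))) hA
  have hmeas (T : Fin n) := measurable_noisyIterate (s := s) hr hΦ D (T + 1)
  have hlaw (T : Fin n) : iterateLaw r Φ s D μ₁ (T + 1) A =
      ∫⁻ w, (Measure.pi fun _ : Fin n => stdGaussian E)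
        {z | noisyIterate r Φ s D w z (T + 1) ∈ A} ∂μ₁ := by
    rw [iterateLaw, Measure.map_apply (hmeas T) hA, Measure.prod_apply (hmeas T hA)]
    rfl
  have hU (T : Fin n) : uniformOn (Set.univ : Set (Fin n)) {T} = (n : ENNReal)⁻¹ := by
    rw [uniformOn_univ]
    simp
  have hP (T : Fin n) := isProbabilityMeasure_iterateLaw (s := s) (μ₁ := μ₁) hr hΦ D (T + 1)
  have hsum : (μ₁.prod ((uniformOn (Set.univ : Set (Fin n))).prod
      (Measure.pi fun _ : Fin n => stdGaussian E)))
        {ω | noisyIterate r Φ s D ω.1 ω.2.2 (ω.2.1 + 1) ∈ A} =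
      (n : ENNReal)⁻¹ * ∑ T : Fin n, iterateLaw r Φ s D μ₁ (T + 1) A := by
    rw [Measure.prod_apply hS, Finset.mul_sum]
    simp_rw [hlaw]
    have (T : Fin n) : Measurable fun w => (Measure.pi fun _ : Fin n => stdGaussian E)
        {z | noisyIterate r Φ s D w z (T + 1) ∈ A} :=
      measurable_measure_prodMk_left (hmeas T hA)
    simp_rw [← lintegral_const_mul _ (this _)]
    rw [← lintegral_finsetSum _ fun T _ => (this T).const_mul _]
    refine lintegral_congr fun w => ?_
    rw [Measure.prod_apply (measurable_prodMk_left hS), lintegral_fintype]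
    refine Finset.sum_congr rfl fun T _ => ?_
    rw [hU, mul_comm]
    rfl
  rw [measureReal_def, hsum, ENNReal.toReal_mul, ENNReal.toReal_sum fun T _ => measure_ne_top _ _]
  simp [measureReal_def]

theorem stopped_noisyIterate_dp (hn : 1 ≤ n) (hγ : 1 ≤ γ) (hs : 0 < s) (hr : Measurable r)
    (hΦ : ∀ x, Measurable (Φ x)) (hΔ : ∀ x w w', ‖Φ x w - Φ x w'‖ ≤ Δ)
    (hκ : ∀ x x' w, ‖Φ x w - Φ x' w‖ ≤ κ) {D D' : Fin n → X} {i : Fin n}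
    (hD : ∀ j, j ≠ i → D j = D' j) {A : Set E} (hA : MeasurableSet A) :
    (μ₁.prod ((uniformOn (Set.univ : Set (Fin n))).prod
      (Measure.pi fun _ : Fin n => stdGaussian E))).real
        {ω | noisyIterate r Φ s D ω.1 ω.2.2 (ω.2.1 + 1) ∈ A} -
      γ * (μ₁.prod ((uniformOn (Set.univ : Set (Fin n))).prod
      (Measure.pi fun _ : Fin n => stdGaussian E))).real
        {ω | noisyIterate r Φ s D' ω.1 ω.2.2 (ω.2.1 + 1) ∈ A} ≤
      1 / (n : ℝ) * theta γ (κ / s) * (1 - theta γ (Δ / s))⁻¹ := by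
  have hκ0 : 0 ≤ κ := (norm_nonneg _).trans (hκ (D i) (D i) 0)
  have hΔ0 : 0 ≤ Δ := (norm_nonneg _).trans (hΔ (D i) 0 0)
  rw [stopped_real_eq_sum hn hr hΦ D hA, stopped_real_eq_sum hn hr hΦ D' hA, mul_left_comm,
    ← mul_sub, mul_assoc, Finset.mul_sum, ← Finset.sum_sub_distrib]
  refine mul_le_mul_of_nonneg_left ?_ (by positivity)
  refine le_trans (Finset.sum_le_sum fun T _ => ?_) (sum_shifted_geometric_le
    (theta_nonneg hγ (by positivity)) (theta_nonneg hγ (by positivity))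
    (theta_lt_one (by linarith)) i)
  split_ifs with hiT
  · obtain ⟨k, hk⟩ := Nat.exists_eq_add_of_le hiT
    rw [hk, add_tsub_cancel_left]
    exact iterateLaw_sub_le hγ hs hr hΦ hΔ hκ hD k (hk ▸ T.2) A hA
  -- Update `i` is not reached: the difference is `1 - γ ≤ 0` times a probability.
  · have hlaw : iterateLaw r Φ s D' μ₁ (T + 1) = iterateLaw r Φ s D μ₁ (T + 1) := by
      unfold iterateLaw
      congr 1
      ext ω : 1
      exact (noisyIterate_congr hD ω.1 ω.2 _ (by omega)).symm
    rw [hlaw]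
    have := mul_nonneg (sub_nonneg.2 hγ)
      (measureReal_nonneg (μ := iterateLaw r Φ s D μ₁ (T + 1)) (s := A))
    linarith

end Abstract


open Filter Topology
open scoped RealInnerProductSpace

/-! ### Gradients of convex functions relative to a convex set. -/

section ConvexGradient

variable {E : Type*} [NormedAddCommGroup E] [InnerProductSpace ℝ E] {W : Set E}

/-- The points around which the ball of radius `ρ`, relative to the affine span of `W`, lies
in `W`. -/
def relInner (W : Set E) (ρ : ℝ) : Set E := {x | ∀ v ∈ vectorSpan ℝ W, ‖v‖ < ρ → x + v ∈ W}

lemma mem_of_mem_relInner {ρ : ℝ} (hρ : 0 < ρ) {x : E} (hx : x ∈ relInner W ρ) : x ∈ W := by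
  simpa using hx 0 (Submodule.zero_mem _) (by simpa using hρ)

lemma convex_relInner (hW : Convex ℝ W) (ρ : ℝ) : Convex ℝ (relInner W ρ) := by
  intro x hx y hy a b ha hb hab v hv hvρ
  have := hW (hx v hv hvρ) (hy v hv hvρ) ha hb hab
  rwa [smul_add, smul_add, add_add_add_comm, ← add_smul, hab, one_smul] at this

lemma relInner_nonempty [FiniteDimensional ℝ E] (hW : Convex ℝ W) (hne : W.Nonempty) :
    ∃ ρ > 0, (relInner W ρ).Nonempty := by
  obtain ⟨_, hx⟩ := hne.intrinsicInterior hW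
  obtain ⟨y, hy, -⟩ := mem_intrinsicInterior.1 hx
  obtain ⟨ρ, hρ, hball⟩ := Metric.isOpen_iff.1 isOpen_interior y hy
  refine ⟨ρ, hρ, y, fun v hv hvρ => ?_⟩
  have hmem : v +ᵥ (y : E) ∈ affineSpan ℝ W :=
    AffineSubspace.vadd_mem_of_mem_direction (by rwa [direction_affineSpan]) y.2
  have := interior_subset (hball (show (⟨v +ᵥ (y : E), hmem⟩ : affineSpan ℝ W) ∈ _ by
    rw [Metric.mem_ball, Subtype.dist_eq]
    simpa [dist_eq_norm] using hvρ))
  simpa [add_comm] using this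

/-- The homothety with centre `w` and ratio `t` maps the relative ball of radius `ρ` around `x` to
one of radius `t ρ`, still inside `W`. -/
lemma combo_mem_relInner (hW : Convex ℝ W) {ρ t : ℝ} (ht : 0 < t) (ht1 : t ≤ 1) {w x : E}
    (hw : w ∈ W) (hx : x ∈ relInner W ρ) : (1 - t) • w + t • x ∈ relInner W (t * ρ) := by
  intro v hv hvρ
  have hx' := hx (t⁻¹ • v) (Submodule.smul_mem _ _ hv) (by
    rw [norm_smul, norm_inv, Real.norm_of_nonneg ht.le, inv_mul_lt_iff₀ ht]
    exact hvρ)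
  have := hW hw hx' (sub_nonneg.2 ht1) ht.le (by ring)
  rwa [smul_add, smul_inv_smul₀ ht.ne', ← add_assoc] at this

lemma sub_mem_vectorSpan {x y : E} (hx : x ∈ W) (hy : y ∈ W) : x - y ∈ vectorSpan ℝ W :=
  vsub_mem_vectorSpan ℝ hx hy

lemma shrink_mem (hW : Convex ℝ W) {w x : E} (hw : w ∈ W) (hx : x ∈ W) (k : ℕ) :
    w + ((k : ℝ) + 1)⁻¹ • (x - w) ∈ W :=
  hW.add_smul_sub_mem hw hx ⟨by positivity, inv_le_one_of_one_le₀ (by linarith [k.cast_nonneg (α := ℝ)])⟩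

lemma norm_gradientStep_sub_le_of_cocoercive {a v : E} {β η : ℝ} (hβ : 0 < β) (hη : 0 ≤ η)
    (hηβ : η ≤ 2 / β) (h : ‖a‖ ^ 2 ≤ β * ⟪a, v⟫) : ‖v - η • a‖ ≤ ‖v‖ := by
  rw [← sq_le_sq₀ (norm_nonneg _) (norm_nonneg _), norm_sub_sq_real, norm_smul,
    real_inner_smul_right, Real.norm_of_nonneg hη, real_inner_comm]
  have h₁ : η * ‖a‖ ^ 2 ≤ 2 / β * (β * ⟪a, v⟫) :=
    mul_le_mul hηβ h (by positivity) (by positivity)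
  -- Hence `η ‖a‖² ≤ 2 ⟪a, v⟫`, which is exactly what makes the expanded square at most `‖v‖²`.
  have h₂ : 2 / β * (β * ⟪a, v⟫) = 2 * ⟪a, v⟫ := by field_simp
  nlinarith

variable [CompleteSpace E] {f : E → ℝ}

lemma tendsto_diffQuotient (hW : Convex ℝ W) {a w x : E} (hf : HasGradientWithinAt f a W w)
    (hw : w ∈ W) (hx : x ∈ W) :
    Tendsto (fun k : ℕ => ((k : ℝ) + 1) * (f (w + ((k : ℝ) + 1)⁻¹ • (x - w)) - f w)) atTop
      (𝓝 ⟪a, x - w⟫) := by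
  have h0 : Tendsto (fun k : ℕ => ((k : ℝ) + 1)⁻¹) atTop (𝓝 0) := by
    simpa [one_div] using tendsto_one_div_add_atTop_nhds_zero_nat (𝕜 := ℝ)
  have hc (k : ℕ) : ((k : ℝ) + 1) • ((k : ℝ) + 1)⁻¹ • (x - w) = x - w :=
    smul_inv_smul₀ (by positivity) _
  have := hf.hasFDerivWithinAt.lim (l := atTop) (c := fun k : ℕ => (k : ℝ) + 1)
    (d := fun k => ((k : ℝ) + 1)⁻¹ • (x - w)) (v := x - w)
    (by simpa using h0.smul_const (x - w)) (Eventually.of_forall fun k => shrink_mem hW hw hx k)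
    (by simp only [hc]; exact tendsto_const_nhds)
  simpa using this

/-- Subtracting the difference quotients at `w` towards `x` and `y` compares `f` at two points of
`W` that are `‖x - y‖ / (k + 1)` apart. So `x - y` need not point into `W` from `w`, which matters
when `w` is on the boundary. -/
lemma inner_gradient_le (hW : Convex ℝ W) {L : ℝ≥0} (hL : LipschitzOnWith L f W) {a w x y : E}
    (hf : HasGradientWithinAt f a W w) (hw : w ∈ W) (hx : x ∈ W) (hy : y ∈ W) :
    ⟪a, x - y⟫ ≤ L * ‖x - y‖ := by
  have h := (tendsto_diffQuotient hW hf hw hx).sub (tendsto_diffQuotient hW hf hw hy)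
  rw [← inner_sub_right, sub_sub_sub_cancel_right] at h
  refine le_of_tendsto h (Eventually.of_forall fun k => ?_)
  have hk : (0 : ℝ) < (k : ℝ) + 1 := by positivity
  have h₁ := hL.dist_le_mul _ (shrink_mem hW hw hx k) _ (shrink_mem hW hw hy k)
  rw [Real.dist_eq, dist_eq_norm, add_sub_add_left_eq_sub, ← smul_sub, sub_sub_sub_cancel_right,
    norm_smul, Real.norm_of_nonneg (by positivity)] at h₁
  have h₂ := mul_le_mul_of_nonneg_left ((le_abs_self _).trans h₁) hk.le
  calc _ = ((k : ℝ) + 1) * (f (w + ((k : ℝ) + 1)⁻¹ • (x - w)) - f (w + ((k : ℝ) + 1)⁻¹ • (y - w))) := by ring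
    _ ≤ _ := h₂
    _ = _ := by field_simp

lemma norm_gradient_le (hW : Convex ℝ W) {ρ : ℝ} (hρ : 0 < ρ) (hne : (relInner W ρ).Nonempty)
    {L : ℝ≥0} (hL : LipschitzOnWith L f W) {a w : E} (hf : HasGradientWithinAt f a W w)
    (hw : w ∈ W) (ha : a ∈ vectorSpan ℝ W) : ‖a‖ ≤ L := by
  obtain ⟨x, hx⟩ := hne
  rcases eq_or_ne a 0 with rfl | ha0
  · simp
  have hpos : 0 < ‖a‖ := norm_pos_iff.2 ha0
  -- Gives `c • a` length `ρ / 2`, so that `x + c • a` stays in `W`.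
  set c := ρ / 2 / ‖a‖ with hc
  have hc0 : 0 < c := by positivity
  have hca : ‖c • a‖ = c * ‖a‖ := by rw [norm_smul, Real.norm_of_nonneg hc0.le]
  have hy : x + c • a ∈ W := hx _ (Submodule.smul_mem _ _ ha) (by
    rw [hca, hc, div_mul_cancel₀ _ hpos.ne']; linarith)
  have := inner_gradient_le hW hL hf hw hy (mem_of_mem_relInner hρ hx)
  rw [add_sub_cancel_left, hca, real_inner_smul_right, real_inner_self_eq_norm_sq] at this
  have h2 : (c * ‖a‖) * ‖a‖ ≤ (c * ‖a‖) * L := by linarith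
  exact le_of_mul_le_mul_left h2 (by positivity)

/-- Only the component of the gradient parallel to `W` matters. -/
lemma hasGradientWithinAt_starProjection [(vectorSpan ℝ W).HasOrthogonalProjection] {a w : E}
    (hf : HasGradientWithinAt f a W w) (hw : w ∈ W) :
    HasGradientWithinAt f ((vectorSpan ℝ W).starProjection a) W w := by
  rw [hasGradientWithinAt_iff_isLittleO] at hf ⊢
  refine hf.congr' ?_ EventuallyEq.rfl
  filter_upwards [self_mem_nhdsWithin] with x hx
  rw [Submodule.inner_starProjection_left_eq_right,
    Submodule.starProjection_eq_self_iff.2 (sub_mem_vectorSpan hx hw)]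

/-- Derivatives towards points of `W` are limits of continuous difference quotients. Differences of
two of them, with endpoints near a relative interior point, give the inner product with every `v` in
the span, and these determine `G` because it is tangential. -/
lemma measurable_gradient_comp [FiniteDimensional ℝ E] [MeasurableSpace E] [BorelSpace E]
    (hW : Convex ℝ W) (hcont : ContinuousOn f W) {G : E → E}
    (hG : ∀ w ∈ W, HasGradientWithinAt f (G w) W w) (hGV : ∀ w ∈ W, G w ∈ vectorSpan ℝ W)
    {q : E → E} (hq : Continuous q) (hqW : ∀ w, q w ∈ W) : Measurable fun w => G (q w) := by
  obtain ⟨ρ, hρ, x, hx⟩ := relInner_nonempty hW ⟨q 0, hqW 0⟩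
  have hdir {y : E} (hy : y ∈ W) : Measurable fun w => ⟪G (q w), y - q w⟫ := by
    refine measurable_of_tendsto_metrizable (f := fun (k : ℕ) w =>
      ((k : ℝ) + 1) * (f (q w + ((k : ℝ) + 1)⁻¹ • (y - q w)) - f (q w))) (fun k => ?_)
      (tendsto_pi_nhds.2 fun w => tendsto_diffQuotient hW (hG _ (hqW w)) (hqW w) hy)
    refine (continuous_const.mul (Continuous.sub ?_ (hcont.comp_continuous hq hqW))).measurable
    exact hcont.comp_continuous (by fun_prop) fun w => shrink_mem hW (hqW w) hy k
  have hV {v : E} (hv : v ∈ vectorSpan ℝ W) : Measurable fun w => ⟪v, G (q w)⟫ := by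
    -- The `+ 1` covers `v = 0` without a case distinction.
    set c := ρ / 2 / (‖v‖ + 1) with hc
    have hc0 : 0 < c := by positivity
    have hy : x + c • v ∈ W := hx _ (Submodule.smul_mem _ _ hv) (by
      rw [norm_smul, Real.norm_of_nonneg hc0.le, hc, div_mul_eq_mul_div,
        div_lt_iff₀ (by positivity)]
      nlinarith [norm_nonneg v])
    convert ((hdir hy).sub (hdir (mem_of_mem_relInner hρ hx))).const_mul c⁻¹ using 2 with w
    simp only [Pi.sub_apply]
    rw [← inner_sub_right, sub_sub_sub_cancel_right, add_sub_cancel_left, real_inner_smul_right,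
      inv_mul_cancel_left₀ hc0.ne', real_inner_comm]
  set b := stdOrthonormalBasis ℝ E
  have : (fun w => G (q w)) =
      fun w => ∑ i, ⟪(vectorSpan ℝ W).starProjection (b i), G (q w)⟫ • b i := by
    ext1 w
    conv_lhs => rw [← b.sum_repr' (G (q w))]
    refine Finset.sum_congr rfl fun i _ => ?_
    rw [Submodule.inner_starProjection_left_eq_right,
      Submodule.starProjection_eq_self_iff.2 (hGV _ (hqW w))]
  rw [this]
  exact Finset.measurable_sum _ fun i _ =>
    (hV (Submodule.starProjection_apply_mem _ _)).smul_const _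

lemma gradient_inequality (hf : ConvexOn ℝ W f) {a w x : E} (ha : HasGradientWithinAt f a W w)
    (hw : w ∈ W) (hx : x ∈ W) : f w + ⟪a, x - w⟫ ≤ f x := by
  have := le_of_tendsto (b := f x - f w) (tendsto_diffQuotient hf.1 ha hw hx)
    (Eventually.of_forall fun k => ?_)
  · linarith
  have hk : (0 : ℝ) < (k : ℝ) + 1 := by positivity
  have hk1 : ((k : ℝ) + 1)⁻¹ ≤ 1 :=
    inv_le_one_of_one_le₀ (by linarith [k.cast_nonneg (α := ℝ)])
  have h := hf.2 hw hx (sub_nonneg.2 hk1) (inv_nonneg.2 hk.le) (by ring)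
  rw [show (1 - ((k : ℝ) + 1)⁻¹) • w + ((k : ℝ) + 1)⁻¹ • x = w + ((k : ℝ) + 1)⁻¹ • (x - w) by
    module, smul_eq_mul, smul_eq_mul] at h
  have h₂ : f (w + ((k : ℝ) + 1)⁻¹ • (x - w)) - f w ≤ ((k : ℝ) + 1)⁻¹ * (f x - f w) := by
    linarith
  calc _ ≤ ((k : ℝ) + 1) * (((k : ℝ) + 1)⁻¹ * (f x - f w)) := mul_le_mul_of_nonneg_left h₂ hk.le
    _ = _ := mul_inv_cancel_left₀ hk.ne' _

lemma descent_inequality (hW : Convex ℝ W) {G : E → E} {β : ℝ≥0}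
    (hG : ∀ w ∈ W, HasGradientWithinAt f (G w) W w) (hβ : LipschitzOnWith β G W) {w x : E}
    (hw : w ∈ W) (hx : x ∈ W) : f x ≤ f w + ⟪G w, x - w⟫ + β / 2 * ‖x - w‖ ^ 2 := by
  set ℓ : ℝ → E := fun t => w + t • (x - w) with hℓ
  have hℓW : ∀ t ∈ Set.Icc (0 : ℝ) 1, ℓ t ∈ W := fun t ht => hW.add_smul_sub_mem hw hx ht
  have hℓd (t : ℝ) : HasDerivAt ℓ (x - w) t := by
    have := ((hasDerivAt_id' t).smul_const (x - w)).const_add w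
    rwa [one_smul] at this
  -- The inequality is `ψ 1 ≤ ψ 0`; `ψ` decreases by Cauchy-Schwarz and the Lipschitz bound on `G`.
  set ψ : ℝ → ℝ := fun t => f (ℓ t) - t * ⟪G w, x - w⟫ - β / 2 * ‖x - w‖ ^ 2 * t ^ 2 with hψ
  have hψd : ∀ t ∈ Set.Icc (0 : ℝ) 1, HasDerivWithinAt ψ
      (⟪G (ℓ t), x - w⟫ - ⟪G w, x - w⟫ - β / 2 * ‖x - w‖ ^ 2 * (2 * t)) (Set.Icc 0 1) t := by
    intro t ht
    have h₁ : HasDerivWithinAt (fun t => f (ℓ t)) ⟪G (ℓ t), x - w⟫ (Set.Icc 0 1) t := by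
      exact (hG _ (hℓW t ht)).hasFDerivWithinAt.comp_hasDerivWithinAt t
        (hℓd t).hasDerivWithinAt hℓW
    have h₂ : HasDerivAt (fun t : ℝ => t * ⟪G w, x - w⟫) ⟪G w, x - w⟫ t := by
      simpa using (hasDerivAt_id t).mul_const ⟪G w, x - w⟫
    have h₃ : HasDerivAt (fun t : ℝ => β / 2 * ‖x - w‖ ^ 2 * t ^ 2)
        (β / 2 * ‖x - w‖ ^ 2 * (2 * t)) t := by
      simpa using (hasDerivAt_pow 2 t).const_mul (β / 2 * ‖x - w‖ ^ 2 : ℝ)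
    exact (h₁.sub h₂.hasDerivWithinAt).sub h₃.hasDerivWithinAt
  have hint : ∀ t ∈ interior (Set.Icc (0 : ℝ) 1), HasDerivAt ψ
      (⟪G (ℓ t), x - w⟫ - ⟪G w, x - w⟫ - β / 2 * ‖x - w‖ ^ 2 * (2 * t)) t := fun t ht =>
    (hψd t (interior_subset ht)).hasDerivAt (mem_interior_iff_mem_nhds.1 ht)
  have hanti : AntitoneOn ψ (Set.Icc 0 1) := by
    refine antitoneOn_of_deriv_nonpos (convex_Icc 0 1)
      (fun t ht => (hψd t ht).continuousWithinAt)
      (fun t ht => (hint t ht).differentiableAt.differentiableWithinAt) fun t ht => ?_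
    rw [(hint t ht).deriv]
    have ht' := interior_subset ht
    have hnorm : ‖G (ℓ t) - G w‖ ≤ β * (t * ‖x - w‖) := by
      have := hβ.dist_le_mul _ (hℓW t ht') _ hw
      rwa [dist_eq_norm, dist_eq_norm, hℓ, add_sub_cancel_left, norm_smul,
        Real.norm_of_nonneg ht'.1] at this
    have hcs := real_inner_le_norm (G (ℓ t) - G w) (x - w)
    rw [inner_sub_left] at hcs
    have := mul_le_mul_of_nonneg_right hnorm (norm_nonneg (x - w))
    nlinarith
  have h01 := hanti (Set.left_mem_Icc.2 zero_le_one) (Set.right_mem_Icc.2 zero_le_one) zero_le_one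
  simp only [hψ, hℓ, one_smul, zero_smul, add_zero, add_sub_cancel, one_mul, zero_mul, one_pow,
    mul_one, sub_zero, ne_eq, OfNat.ofNat_ne_zero, not_false_eq_true, zero_pow, mul_zero] at h01
  linarith

/-- The Baillon-Haddad inequality, between two points with enough room around them. -/
lemma cocoercive_of_add_mem (hf : ConvexOn ℝ W f) {G : E → E} {β : ℝ≥0} (hβ0 : 0 < β)
    (hG : ∀ w ∈ W, HasGradientWithinAt f (G w) W w) (hβ : LipschitzOnWith β G W) {x y : E}
    (hx : x ∈ W) (hy : y ∈ W) (hx' : x - (β : ℝ)⁻¹ • (G x - G y) ∈ W)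
    (hy' : y - (β : ℝ)⁻¹ • (G y - G x) ∈ W) :
    ‖G x - G y‖ ^ 2 ≤ β * ⟪G x - G y, x - y⟫ := by
  have hb : (0 : ℝ) < β := hβ0
  -- The test point minimizes the quadratic upper bound at `x` for `f - ⟪G y, ·⟫`; convexity bounds
  -- that function below by its value at `y`. Adding the same with `x` and `y` exchanged gives
  -- cocoercivity.
  have key {x y : E} (hx : x ∈ W) (hy : y ∈ W) (hx' : x - (β : ℝ)⁻¹ • (G x - G y) ∈ W) :
      f y + ⟪G y, x - y⟫ ≤ f x - (β : ℝ)⁻¹ / 2 * ‖G x - G y‖ ^ 2 := by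
    have h₁ := descent_inequality hf.1 hG hβ hx hx'
    have h₂ := gradient_inequality hf (hG y hy) hy hx'
    rw [sub_sub_cancel_left, inner_neg_right, norm_neg, norm_smul, real_inner_smul_right,
      Real.norm_of_nonneg (by positivity), mul_pow] at h₁
    rw [sub_right_comm, inner_sub_right, real_inner_smul_right] at h₂
    have h₃ : (β : ℝ) / 2 * ((β : ℝ)⁻¹ ^ 2 * ‖G x - G y‖ ^ 2) =
        (β : ℝ)⁻¹ / 2 * ‖G x - G y‖ ^ 2 := by field_simp
    have h₄ : (β : ℝ)⁻¹ * ⟪G x, G x - G y⟫ - (β : ℝ)⁻¹ * ⟪G y, G x - G y⟫ =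
        (β : ℝ)⁻¹ * ‖G x - G y‖ ^ 2 := by
      rw [← mul_sub, ← inner_sub_left, real_inner_self_eq_norm_sq]
    linarith
  have k₁ := key hx hy hx'
  have k₂ := key hy hx hy'
  rw [← neg_sub x y, inner_neg_right, norm_sub_rev (G y)] at k₂
  rw [inner_sub_left]
  have : (β : ℝ)⁻¹ * ‖G x - G y‖ ^ 2 ≤ ⟪G x, x - y⟫ - ⟪G y, x - y⟫ := by linarith
  rwa [inv_mul_le_iff₀ hb] at this

/-- The test points in `cocoercive_of_add_mem` lie within `‖x - y‖` of `x` and `y`, so they are in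
`W` once `‖x - y‖ < ρ`. For distant points the segment is cut into pieces shorter than `ρ`, whose
lengths add up to `‖x - y‖`. -/
lemma norm_gradientStep_sub_le_relInner (hf : ConvexOn ℝ W f) {G : E → E} {β : ℝ≥0}
    (hβ0 : 0 < β) (hG : ∀ w ∈ W, HasGradientWithinAt f (G w) W w)
    (hGV : ∀ w ∈ W, G w ∈ vectorSpan ℝ W) (hβ : LipschitzOnWith β G W) {η : ℝ} (hη : 0 ≤ η)
    (hηβ : η ≤ 2 / (β : ℝ)) {ρ : ℝ} (hρ : 0 < ρ) {x y : E} (hx : x ∈ relInner W ρ)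
    (hy : y ∈ relInner W ρ) : ‖(x - η • G x) - (y - η • G y)‖ ≤ ‖x - y‖ := by
  have hb : (0 : ℝ) < β := hβ0
  have hlocal {x y : E} (hx : x ∈ relInner W ρ) (hy : y ∈ relInner W ρ) (hxy : ‖x - y‖ < ρ) :
      ‖(x - η • G x) - (y - η • G y)‖ ≤ ‖x - y‖ := by
    have hroom {x y : E} (hx : x ∈ relInner W ρ) (hy : y ∈ relInner W ρ) (hxy : ‖x - y‖ < ρ) :
        x - (β : ℝ)⁻¹ • (G x - G y) ∈ W := by
      have hxW := mem_of_mem_relInner hρ hx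
      have hyW := mem_of_mem_relInner hρ hy
      rw [sub_eq_add_neg]
      refine hx _ (Submodule.neg_mem _ (Submodule.smul_mem _ _
        (Submodule.sub_mem _ (hGV x hxW) (hGV y hyW)))) ?_
      have := hβ.dist_le_mul _ hxW _ hyW
      rw [dist_eq_norm, dist_eq_norm] at this
      rw [norm_neg, norm_smul, Real.norm_of_nonneg (by positivity)]
      exact ((inv_mul_le_iff₀ hb).2 this).trans_lt hxy
    have := norm_gradientStep_sub_le_of_cocoercive hb hη hηβ (cocoercive_of_add_mem hf hβ0 hG hβ
      (mem_of_mem_relInner hρ hx) (mem_of_mem_relInner hρ hy) (hroom hx hy hxy)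
      (hroom hy hx (by rwa [norm_sub_rev])))
    rwa [show (x - η • G x) - (y - η • G y) = x - y - η • (G x - G y) by module]
  obtain ⟨N, hN⟩ := exists_nat_gt (‖x - y‖ / ρ)
  have hN0 : (0 : ℝ) < N := lt_of_le_of_lt (by positivity) hN
  set p : ℕ → E := fun k => y + ((k : ℝ) / N) • (x - y) with hp
  have hpmem (k : ℕ) (hk : k ≤ N) : p k ∈ relInner W ρ :=
    (convex_relInner hf.1 ρ).add_smul_sub_mem hy hx ⟨by positivity, by
      rw [div_le_one hN0]; exact_mod_cast hk⟩
  have hstep (k : ℕ) : ‖p k - p (k + 1)‖ = ‖x - y‖ / N := by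
    rw [hp, show y + ((k : ℝ) / N) • (x - y) - (y + (((k + 1 : ℕ) : ℝ) / N) • (x - y)) =
      -((1 / (N : ℝ)) • (x - y)) by push_cast; module, norm_neg, norm_smul,
      Real.norm_of_nonneg (by positivity)]
    ring
  have h := dist_le_range_sum_of_dist_le (f := fun k => p k - η • G (p k)) N
    (d := fun _ => ‖x - y‖ / N) fun {k} hk => by
      rw [dist_eq_norm, ← hstep k]
      refine hlocal (hpmem k hk.le) (hpmem (k + 1) hk) ?_
      rw [hstep, div_lt_iff₀ hN0, mul_comm]
      exact (div_lt_iff₀ hρ).1 hN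
  have hp0 : p 0 = y := by simp [hp]
  have hpN : p N = x := by simp [hp, div_self hN0.ne']
  rw [hp0, hpN, dist_comm, dist_eq_norm, Finset.sum_const, Finset.card_range, nsmul_eq_mul,
    mul_div_cancel₀ _ hN0.ne'] at h
  exact h

/-- A gradient step with step size at most `2 / β` is nonexpansive on a convex set `W`, for a
function that is only defined, convex and `β`-smooth on `W`. -/
theorem norm_gradientStep_sub_le [FiniteDimensional ℝ E] (hf : ConvexOn ℝ W f) {G : E → E}
    {β : ℝ≥0} (hβ0 : 0 < β) (hG : ∀ w ∈ W, HasGradientWithinAt f (G w) W w)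
    (hGV : ∀ w ∈ W, G w ∈ vectorSpan ℝ W) (hβ : LipschitzOnWith β G W) {η : ℝ} (hη : 0 ≤ η)
    (hηβ : η ≤ 2 / (β : ℝ)) {x y : E} (hx : x ∈ W) (hy : y ∈ W) :
    ‖(x - η • G x) - (y - η • G y)‖ ≤ ‖x - y‖ := by
  obtain ⟨ρ, hρ, o, ho⟩ := relInner_nonempty hf.1 ⟨x, hx⟩
  have hev : ∀ᶠ t : ℝ in 𝓝[>] 0, t ∈ Set.Ioo (0 : ℝ) 1 := Ioo_mem_nhdsGT one_pos
  -- Boundary points are reached by sliding both points towards `o` and letting `t → 0⁺`; the room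
  -- `t ρ` vanishes, but the estimate does not depend on it.
  have hlim {x : E} (hx : x ∈ W) : Tendsto (fun t : ℝ => (1 - t) • x + t • o) (𝓝[>] 0) (𝓝[W] x) := by
    refine tendsto_nhdsWithin_iff.2 ⟨?_, ?_⟩
    · have : Continuous fun t : ℝ => (1 - t) • x + t • o := by fun_prop
      simpa using (this.tendsto 0).mono_left nhdsWithin_le_nhds
    · filter_upwards [hev] with t ht
      exact mem_of_mem_relInner (mul_pos ht.1 hρ)
        (combo_mem_relInner hf.1 ht.1 ht.2.le hx ho)
  have hΦ : ContinuousOn (fun x => x - η • G x) W :=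
    continuousOn_id.sub (hβ.continuousOn.const_smul η)
  refine le_of_tendsto (((hΦ x hx).tendsto.comp (hlim hx)).sub
    ((hΦ y hy).tendsto.comp (hlim hy))).norm ?_
  filter_upwards [hev] with t ht
  refine (norm_gradientStep_sub_le_relInner hf hβ0 hG hGV hβ hη hηβ (mul_pos ht.1 hρ)
    (combo_mem_relInner hf.1 ht.1 ht.2.le hx ho)
    (combo_mem_relInner hf.1 ht.1 ht.2.le hy ho)).trans ?_
  rw [add_sub_add_right_eq_sub, ← smul_sub, norm_smul,
    Real.norm_of_nonneg (sub_nonneg.2 ht.2.le)]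
  exact mul_le_of_le_one_left (norm_nonneg _) (by linarith [ht.1])

end ConvexGradient

/-! ### Euclidean projection onto a closed convex set. -/

section Projection

variable {d : ℕ} {W : Set (EuclideanSpace ℝ (Fin d))}

lemma inner_sub_proj_le_zero (hne : W.Nonempty) (hcl : IsClosed W) (hW : Convex ℝ W)
    (z : EuclideanSpace ℝ (Fin d)) {q : EuclideanSpace ℝ (Fin d)} (hq : q ∈ W) :
    ⟪z - proj W z, q - proj W z⟫ ≤ 0 := by
  obtain ⟨hmem, hle⟩ := proj_spec hne hcl z
  refine (norm_eq_iInf_iff_real_inner_le_zero hW hmem).1 (le_antisymm ?_ ?_) q hq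
  · have : Nonempty W := ⟨⟨_, hmem⟩⟩
    exact le_ciInf fun w => hle w w.2
  · exact ciInf_le (f := fun w : W => ‖z - w‖) ⟨0, by rintro _ ⟨w, rfl⟩; exact norm_nonneg _⟩
      ⟨_, hmem⟩

/-- Firm nonexpansiveness, the sum of the two variational inequalities. It yields both continuity of
`proj` and its blindness to displacements orthogonal to the span. -/
lemma norm_proj_sub_sq_le (hne : W.Nonempty) (hcl : IsClosed W) (hW : Convex ℝ W)
    (z z' : EuclideanSpace ℝ (Fin d)) :
    ‖proj W z - proj W z'‖ ^ 2 ≤ ⟪z - z', proj W z - proj W z'⟫ := by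
  have h₁ := inner_sub_proj_le_zero hne hcl hW z (proj_spec hne hcl z').1
  have h₂ := inner_sub_proj_le_zero hne hcl hW z' (proj_spec hne hcl z).1
  rw [← neg_sub (proj W z) (proj W z'), inner_neg_right] at h₁
  have h₃ : ⟪z' - proj W z', proj W z - proj W z'⟫ - ⟪z - proj W z, proj W z - proj W z'⟫ =
      ‖proj W z - proj W z'‖ ^ 2 - ⟪z - z', proj W z - proj W z'⟫ := by
    rw [← inner_sub_left, ← real_inner_self_eq_norm_sq, ← inner_sub_left]
    congr 1
    abel
  linarith

lemma continuous_proj (hne : W.Nonempty) (hcl : IsClosed W) (hW : Convex ℝ W) :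
    Continuous (proj W) := by
  refine (LipschitzWith.of_dist_le_mul (K := 1) fun z z' => ?_).continuous
  rw [dist_eq_norm, dist_eq_norm, NNReal.coe_one, one_mul]
  have h₁ := (norm_proj_sub_sq_le hne hcl hW z z').trans (real_inner_le_norm _ _)
  rcases (norm_nonneg (proj W z - proj W z')).eq_or_lt with h | h
  · rw [← h]; exact norm_nonneg _
  · rw [sq] at h₁
    exact le_of_mul_le_mul_right h₁ h

lemma proj_eq_of_sub_mem_orthogonal (hne : W.Nonempty) (hcl : IsClosed W) (hW : Convex ℝ W)
    {z z' : EuclideanSpace ℝ (Fin d)} (h : z - z' ∈ (vectorSpan ℝ W)ᗮ) :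
    proj W z = proj W z' := by
  have h₁ := norm_proj_sub_sq_le hne hcl hW z z'
  rw [Submodule.inner_left_of_mem_orthogonal
    (sub_mem_vectorSpan (proj_spec hne hcl z).1 (proj_spec hne hcl z').1) h] at h₁
  exact sub_eq_zero.1 (norm_eq_zero.1 (pow_eq_zero_iff two_ne_zero |>.1
    (le_antisymm h₁ (sq_nonneg _))))

lemma proj_of_mem (hcl : IsClosed W) {w : EuclideanSpace ℝ (Fin d)} (hw : w ∈ W) :
    proj W w = w := by
  have := (proj_spec ⟨w, hw⟩ hcl w).2 w hw
  rw [sub_self, norm_zero] at this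
  exact (sub_eq_zero.1 (norm_le_zero_iff.1 this)).symm

end Projection


/-! ### Projected SGD as an instance of the abstract iteration. -/

section ProjectedSGD

variable {d n : ℕ} {X : Type*} {W : Set (EuclideanSpace ℝ (Fin d))}
  {g : X → EuclideanSpace ℝ (Fin d) → EuclideanSpace ℝ (Fin d)} {η σ : ℝ}

/-- The gradient step from the projection of `w`, along the component of the gradient parallel
to `W`. -/
noncomputable def tangentialStep (W : Set (EuclideanSpace ℝ (Fin d)))
    (g : X → EuclideanSpace ℝ (Fin d) → EuclideanSpace ℝ (Fin d)) (η : ℝ) (x : X)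
    (w : EuclideanSpace ℝ (Fin d)) : EuclideanSpace ℝ (Fin d) :=
  proj W w - η • (vectorSpan ℝ W).starProjection (g x (proj W w))

/-- The arguments of the outer projection differ by the normal part of the gradient, which `proj W`
does not see. The inner projection in `tangentialStep` makes the step bounds global and is the
identity on iterates, which stay in `W`. -/
lemma iterate_eq_noisyIterate (hcl : IsClosed W) (hW : Convex ℝ W) (D : Fin n → X)
    {w₁ : EuclideanSpace ℝ (Fin d)} (hw₁ : w₁ ∈ W) (z : Fin n → EuclideanSpace ℝ (Fin d))
    (t : ℕ) :
    iterate W g η σ D w₁ z t ∈ W ∧ iterate W g η σ D w₁ z t =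
      noisyIterate (proj W) (tangentialStep W g η) (η * σ) D w₁ z t := by
  have hne : W.Nonempty := ⟨w₁, hw₁⟩
  induction t with
  | zero => exact ⟨hw₁, rfl⟩
  | succ t ih =>
    simp only [iterate, noisyIterate]
    rw [← ih.2]
    split_ifs with h
    · refine ⟨(proj_spec hne hcl _).1, proj_eq_of_sub_mem_orthogonal hne hcl hW ?_⟩
      rw [tangentialStep, proj_of_mem hcl ih.1]
      set w := iterate W g η σ D w₁ z t
      set a := g (D ⟨t, h⟩) w
      have : (w - η • (a + σ • z ⟨t, h⟩) -
          (w - η • (vectorSpan ℝ W).starProjection a - (η * σ) • z ⟨t, h⟩)) =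
          -(η • (a - (vectorSpan ℝ W).starProjection a)) := by module
      rw [this]
      exact Submodule.neg_mem _ (Submodule.smul_mem _ _
        (Submodule.sub_starProjection_mem_orthogonal a))
    · exact ⟨ih.1, rfl⟩

theorem output_isDP (hn : 1 ≤ n) (hcl : IsClosed W) (hW : Convex ℝ W) (hne : W.Nonempty)
    (hη : 0 < η) (hσ : 0 < σ) {ε : ℝ} (hε : 0 ≤ ε)
    (μ₁ : Measure (EuclideanSpace ℝ (Fin d))) [IsProbabilityMeasure μ₁] (hμ₁ : μ₁ Wᶜ = 0)
    (hmeas : ∀ x, Measurable (tangentialStep W g η x)) {Δ L : ℝ}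
    (hΔ : ∀ x w w', ‖tangentialStep W g η x w - tangentialStep W g η x w'‖ ≤ Δ)
    (hL : ∀ x, ∀ w ∈ W, ‖(vectorSpan ℝ W).starProjection (g x w)‖ ≤ L) :
    IsDP (sampleMeasure n μ₁) (output (n := n) W g η σ) ε
      (1 / (n : ℝ) * theta (Real.exp ε) (2 * L / σ) * (1 - theta (Real.exp ε) (Δ / (η * σ)))⁻¹) := by
  intro i D D' hDD' A hA
  have : Nonempty (Fin n) := ⟨i⟩
  have hmem : ∀ᵐ ω ∂(sampleMeasure n μ₁), ω.1 ∈ W :=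
    Measure.quasiMeasurePreserving_fst.ae (show ∀ᵐ w ∂μ₁, w ∈ W from hμ₁)
  have hout (D : Fin n → X) : (sampleMeasure n μ₁).real {ω | output W g η σ D ω ∈ A} =
      (sampleMeasure n μ₁).real {ω | noisyIterate (proj W) (tangentialStep W g η) (η * σ) D
        ω.1 ω.2.2 (ω.2.1 + 1) ∈ A} := by
    refine measureReal_congr ?_
    filter_upwards [hmem] with ω hω
    refine propext ?_
    change iterate W g η σ D ω.1 ω.2.2 (ω.2.1 + 1) ∈ A ↔ _
    rw [(iterate_eq_noisyIterate hcl hW D hω ω.2.2 (ω.2.1 + 1)).2]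
    rfl
  have hκ (x x' : X) (w : EuclideanSpace ℝ (Fin d)) :
      ‖tangentialStep W g η x w - tangentialStep W g η x' w‖ ≤ 2 * η * L := by
    have hw := (proj_spec hne hcl w).1
    rw [tangentialStep, tangentialStep, sub_sub_sub_cancel_left, ← smul_sub, norm_smul,
      Real.norm_of_nonneg hη.le]
    have := (norm_sub_le _ _).trans (add_le_add (hL x' _ hw) (hL x _ hw))
    nlinarith
  have := stopped_noisyIterate_dp (μ₁ := μ₁) hn (Real.one_le_exp hε) (mul_pos hη hσ)
    (continuous_proj hne hcl hW).measurable hmeas hΔ hκ hDD'.2 hA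
  rw [hout, hout]
  rwa [show 2 * η * L / (η * σ) = 2 * L / σ by field_simp] at this

end ProjectedSGD

end PNSGD

/-! ### The two privacy bounds. -/

theorem corollary1 {d n : ℕ} (hn : 1 ≤ n) {X : Type*}
    (W : Set (EuclideanSpace ℝ (Fin d))) (hWclosed : IsClosed W) (hWconvex : Convex ℝ W)
    (hWdiam : Metric.diam W = 1)
    (loss : EuclideanSpace ℝ (Fin d) → X → ℝ)
    (g : X → EuclideanSpace ℝ (Fin d) → EuclideanSpace ℝ (Fin d)) (L : ℝ≥0)
    (hconvex : ∀ x, ConvexOn ℝ W (fun w => loss w x))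
    (hgrad : ∀ x, ∀ w ∈ W, HasGradientWithinAt (fun w => loss w x) (g x w) W w)
    (hLip : ∀ x, LipschitzOnWith L (fun w => loss w x) W)
    (μ₁ : Measure (EuclideanSpace ℝ (Fin d))) [IsProbabilityMeasure μ₁] (hμ₁ : μ₁ Wᶜ = 0)
    (η σ ε : ℝ) (hη : 0 < η) (hσ : 0 < σ) (hε : 0 ≤ ε) :
    PNSGD.IsDP (PNSGD.sampleMeasure n μ₁) (PNSGD.output (n := n) W g η σ) ε
      (1 / (n : ℝ) * PNSGD.theta (Real.exp ε) (2 * L / σ)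
        * (1 - PNSGD.theta (Real.exp ε) ((1 + 2 * η * L) / (η * σ)))⁻¹) ∧
    ∀ β : ℝ≥0, 0 < β → (∀ x, LipschitzOnWith β (g x) W) → η ≤ 2 / (β : ℝ) →
      PNSGD.IsDP (PNSGD.sampleMeasure n μ₁) (PNSGD.output (n := n) W g η σ) ε
        (1 / (n : ℝ) * PNSGD.theta (Real.exp ε) (2 * L / σ)
          * (1 - PNSGD.theta (Real.exp ε) (1 / (η * σ)))⁻¹) := by
  -- `Metric.diam` is `0` by convention on empty and on unbounded sets, so diameter `1` makes `W`
  -- both nonempty and bounded.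
  have hne : W.Nonempty := by
    rw [Set.nonempty_iff_ne_empty]
    rintro rfl
    simp at hWdiam
  have hbdd : Bornology.IsBounded W := by
    by_contra h
    rw [Metric.diam_eq_zero_of_unbounded h] at hWdiam
    exact zero_ne_one hWdiam
  set P := (vectorSpan ℝ W).starProjection
  have hP (x : X) : ∀ w ∈ W, HasGradientWithinAt (fun w => loss w x) (P (g x w)) W w :=
    fun w hw => PNSGD.hasGradientWithinAt_starProjection (hgrad x w hw) hw
  have hPV (x : X) : ∀ w ∈ W, P (g x w) ∈ vectorSpan ℝ W :=
    fun w _ => Submodule.starProjection_apply_mem _ _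
  obtain ⟨ρ, hρ, hrel⟩ := PNSGD.relInner_nonempty hWconvex hne
  have hPL (x : X) : ∀ w ∈ W, ‖P (g x w)‖ ≤ L := fun w hw =>
    PNSGD.norm_gradient_le hWconvex hρ hrel (hLip x) (hP x w hw) hw (hPV x w hw)
  have hq := PNSGD.continuous_proj hne hWclosed hWconvex
  have hqW (w : EuclideanSpace ℝ (Fin d)) : PNSGD.proj W w ∈ W :=
    (PNSGD.proj_spec hne hWclosed w).1
  have hdiam (w w' : EuclideanSpace ℝ (Fin d)) : ‖PNSGD.proj W w - PNSGD.proj W w'‖ ≤ 1 := by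
    rw [← dist_eq_norm, ← hWdiam]
    exact Metric.dist_le_diam_of_mem hbdd (hqW w) (hqW w')
  have hmeas (x : X) : Measurable (PNSGD.tangentialStep W g η x) :=
    hq.measurable.sub ((PNSGD.measurable_gradient_comp hWconvex (hLip x).continuousOn (hP x)
      (hPV x) hq hqW).const_smul η)
  refine ⟨PNSGD.output_isDP hn hWclosed hWconvex hne hη hσ hε μ₁ hμ₁ hmeas
    (fun x w w' => ?_) hPL, fun β hβ0 hβ hηβ =>
    PNSGD.output_isDP hn hWclosed hWconvex hne hη hσ hε μ₁ hμ₁ hmeas (fun x w w' => ?_) hPL⟩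
  -- Without smoothness: the projected points are at most `1` apart and the two gradient moves have
  -- length at most `ηL` each.
  · rw [PNSGD.tangentialStep, PNSGD.tangentialStep, sub_sub_sub_comm, ← smul_sub]
    refine (norm_sub_le _ _).trans ?_
    rw [norm_smul, Real.norm_of_nonneg hη.le]
    have h₁ := (norm_sub_le _ _).trans (add_le_add (hPL x _ (hqW w)) (hPL x _ (hqW w')))
    have h₂ := mul_le_mul_of_nonneg_left h₁ hη.le
    have h₃ := hdiam w w'
    linarith
  -- Orthogonal projection does not increase norms, so the tangential gradient keeps the smoothness
  -- constant `β`.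
  · have hPβ : LipschitzOnWith β (fun w => P (g x w)) W := by
      refine LipschitzOnWith.of_dist_le_mul fun a ha b hb => ?_
      refine le_trans ?_ ((hβ x).dist_le_mul a ha b hb)
      rw [dist_eq_norm, dist_eq_norm, ← map_sub]
      exact Submodule.norm_starProjection_apply_le _ _
    exact (PNSGD.norm_gradientStep_sub_le (hconvex x) hβ0 (hP x) (hPV x) hPβ hη.le hηβ
      (hqW w) (hqW w')).trans (hdiam w w')
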